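/- Let $\mathbb K$ be a field of characteristic zero, let $\mathbb F$ be an algebraic closure of $\mathbb K$, and let $\mathbb L=\mathbb K(\alpha)$ be a finite extension of $\mathbb K$ of degree $n$ with primitive element $\alpha$. A unit of $\mathbb L(t)$ is a rational function $u(t)=\frac{at+b}{ct+d}$ with $a,b,c,d\in\mathbb L$ and $ad-bc\neq 0$. Write $u(t)=\sum_{i=0}^{n-1}\phi_i(t)\alpha^i$ with (unique) $\phi_i\in\mathbb K(t)$. The $\alpha$-hypercircle generated by $u$ is the curve $\mathcal U\subseteq\mathbb F^n$ parametrized by $(\phi_0,\dots,\phi_{n-1})$, that is, the Zariski closure of the set of the points $(\phi_0(t),\dots,\phi_{n-1}(t))$, where $t$ runs over the elements of $\mathbb F$ at which all $\phi_i$ are defined. Let $\mathbb S$ be $\mathbb K$ or $\mathbb F$. The curve $\mathcal U$ is polynomially parametrizable over $\mathbb S$ if there are polynomials $P_0,\dots,P_{n-1}\in\mathbb S[t]$ such that $\mathcal U$ is the Zariski closure of $\{(P_0(t),\dots,P_{n-1}(t)) : t\in\mathbb F\}$. A local parametrization of $\mathcal U$ over $\mathbb S$ at infinity is a tuple $\xi\in\mathbb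 S((s))^n$ of formal Laurent series that satisfies every polynomial equation of $\mathcal U$ and has at least one component of negative order. It is irreducible if it is not of the form $\zeta(h(s))$ with $\zeta\in\mathbb S((s))^n$ and a nonzero $h\in\mathbb S[[s]]$ of order at least $2$. Two of them, $\xi$ and $\eta$, are equivalent if $\eta(s)=\xi(h(s))$ for some $h\in\mathbb S[[s]]$ of order $1$. A branch of $\mathcal U$ over $\mathbb S$ at infinity is an equivalence class of irreducible local parametrizations of $\mathcal U$ over $\mathbb S$ at infinity. Theorem. Let $\mathcal U$ be the $\alpha$-hypercircle generated by a unit $u(t)$ of $\mathbb L(t)$. The following statements are equivalent: 1. $\mathcal U$ is a line in $\mathbb F^n$. 2. $\mathcal U$ is generated by a unit of $\mathbb L(t)$ that is a polynomial. 3. For every non-polynomial unit of $\mathbb L(t)$ that generates $\mathcal U$, the root of its denominator belongs to $\mathbb K$. 4. $\mathcal U$ is polynomially parametrizable over $\mathbb F$. 5. $\mathcal U$ has exactly one branch over $\mathbb F$ at infinity. 6. $\mathcal U$ is polynomially parametrizable over $\mathbb K$. 7. $\mathcal U$ has exactly one branch over $\mathbb K$ at infinity. -/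

import Mathlib

noncomputable section

namespace Hypercircle

/-- `u ∈ L(t)` is a unit for composition: `u = (a t + b) / (c t + d)` with `a d - b c ≠ 0`. -/
def IsCompUnit {L : Type*} [Field L] (u : RatFunc L) : Prop :=
  ∃ a b c d : L, a * d - b * c ≠ 0 ∧
    u = (RatFunc.C a * RatFunc.X + RatFunc.C b) / (RatFunc.C c * RatFunc.X + RatFunc.C d)

/-- The rational function `u ∈ L(t)` is a polynomial. -/
def IsPoly {L : Type*} [Field L] (u : RatFunc L) : Prop :=
  ∃ p : Polynomial L, u = algebraMap (Polynomial L) (RatFunc L) p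

/-- The embedding `K(t) → L(t)` induced by a field extension `K → L`. -/
def baseChange (K L : Type*) [Field K] [Field L] [Algebra K L] : RatFunc K →+* RatFunc L :=
  RatFunc.mapRingHom (Polynomial.mapRingHom (algebraMap K L))
    (nonZeroDivisors_le_comap_nonZeroDivisors_of_injective _
      (Polynomial.map_injective _ (algebraMap K L).injective))

/-- The Zariski closed subset of `Fⁿ` parametrized by a tuple `φ` of rational functions over `S`:
the Zariski closure (over `F`) of the set of all points `φ(t)`, where `t ∈ F` is not a zero of any
of the denominators. -/
def paramCurve {S : Type*} (F : Type*) [Field S] [Field F] [Algebra S F] {n : ℕ}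
    (φ : Fin n → RatFunc S) : Set (Fin n → F) :=
  MvPolynomial.zeroLocus F (MvPolynomial.vanishingIdeal F
    {x : Fin n → F | ∃ t : F, (∀ i, Polynomial.eval₂ (algebraMap S F) t (φ i).denom ≠ 0) ∧
      ∀ i, x i = Polynomial.eval₂ (algebraMap S F) t (φ i).num /
        Polynomial.eval₂ (algebraMap S F) t (φ i).denom})

/-- `U ⊆ Fⁿ`, `n = [L : K]`, is the `α`-hypercircle generated by `u ∈ L(t)`: `u` is a unit for
composition, and `U` is parametrized by `(φ₀, …, φₙ₋₁) ∈ K(t)ⁿ`, where `u = ∑ φᵢ αⁱ`. -/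
def Generates {K L F : Type*} [Field K] [Field L] [Field F] [Algebra K L] [Algebra K F]
    (α : L) (u : RatFunc L) (U : Set (Fin (Module.finrank K L) → F)) : Prop :=
  IsCompUnit u ∧ ∃ φ : Fin (Module.finrank K L) → RatFunc K,
    u = ∑ i, baseChange K L (φ i) * RatFunc.C (α ^ (i : ℕ)) ∧ U = paramCurve F φ

/-- `U` is a straight line in `Fⁿ`. -/
def IsLine {F : Type*} [Field F] {n : ℕ} (U : Set (Fin n → F)) : Prop :=
  ∃ p v : Fin n → F, v ≠ 0 ∧ U = {x | ∃ s : F, x = p + s • v}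

/-- `U` admits a parametrization by polynomials with coefficients in `S`. -/
def PolyParametrizable (S : Type*) {F : Type*} [Field S] [Field F] [Algebra S F] {n : ℕ}
    (U : Set (Fin n → F)) : Prop :=
  ∃ P : Fin n → Polynomial S,
    U = paramCurve F (fun i => algebraMap (Polynomial S) (RatFunc S) (P i))

/-- `η = ξ ∘ h`: the tuple `η` of Laurent series arises from the tuple `ξ` by substituting the
power series `h` (to be used for `h ≠ 0` with zero constant term) for the variable `X`.
Here `ξ = X⁻ᵏ f` with a tuple `f` of power series, and `ξ ∘ h = h⁻ᵏ (f ∘ h)`. -/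
def IsSubst {S : Type*} [Field S] {n : ℕ} (ξ : Fin n → LaurentSeries S) (h : PowerSeries S)
    (η : Fin n → LaurentSeries S) : Prop :=
  ∃ (k : ℕ) (f : Fin n → PowerSeries S),
    (∀ i, HahnSeries.ofPowerSeries ℤ S PowerSeries.X ^ k * ξ i
      = HahnSeries.ofPowerSeries ℤ S (f i)) ∧
    ∀ i, HahnSeries.ofPowerSeries ℤ S h ^ k * η i
      = HahnSeries.ofPowerSeries ℤ S (PowerSeries.subst h (f i))

/-- `ξ` is reducible: it arises from some tuple by a substitution of order at least two. -/
def IsReducible {S : Type*} [Field S] {n : ℕ} (ξ : Fin n → LaurentSeries S) : Prop :=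
  ∃ (ζ : Fin n → LaurentSeries S) (h : PowerSeries S) (m : ℕ),
    2 ≤ m ∧ h.order = m ∧ IsSubst ζ h ξ

/-- `ξ` and `η` are equivalent: they differ by a substitution of order one. -/
def Equivalent {S : Type*} [Field S] {n : ℕ} (ξ η : Fin n → LaurentSeries S) : Prop :=
  ∃ h : PowerSeries S, h.order = 1 ∧ IsSubst ξ h η

/-- `ξ` is an irreducible local parametrization over `S`, centered at infinity, of the algebraic
set `U`: the Laurent series `ξᵢ` have coefficients in `S`, they satisfy all polynomial equations
of `U`, at least one of them has a pole, and `ξ` is not reducible. -/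
structure IsParamAtInfinity {S F : Type*} [Field S] [Field F] [Algebra S F] {n : ℕ}
    (U : Set (Fin n → F)) (ξ : Fin n → LaurentSeries S) : Prop where
  equations : ∀ p ∈ MvPolynomial.vanishingIdeal F U,
    MvPolynomial.aeval (fun i => (ξ i).map (algebraMap S F)) p = 0
  pole : ∃ i, (ξ i).order < 0
  irreducible : ¬ IsReducible ξ

/-- `U` has exactly one branch over `S` at infinity. A branch over `S` is an equivalence class of
irreducible local parametrizations with coefficients in `S`. -/
def OneBranchAtInfinity (S : Type*) {F : Type*} [Field S] [Field F] [Algebra S F] {n : ℕ}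
    (U : Set (Fin n → F)) : Prop :=
  (∃ ξ : Fin n → LaurentSeries S, IsParamAtInfinity U ξ) ∧
    ∀ ξ η : Fin n → LaurentSeries S,
      IsParamAtInfinity U ξ → IsParamAtInfinity U η → Equivalent ξ η

end Hypercircle

end

/-! Up to normalization a unit is `b + a t` or `a + b / (t + d)`. In the first case, and in the
second when `d` lies in `K`, expanding `a` and `b` in powers of `α` gives coordinates `pᵢ + vᵢ t` or
`pᵢ + vᵢ / (t + k)` with `pᵢ, vᵢ ∈ K`. Then `U` is a line defined over `K`
(`Generates.eq_baseLine_of_root`), and such a line has all the listed properties; in particular its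
only branch at infinity is that of `p + s⁻¹ v` (`oneBranchAtInfinity_baseLine`).

If `d ∉ K`, two embeddings `σ, τ` of `L` into `F` separate `d`. The linear form with coefficients `σ
(αⁱ)` takes the value `σ a + σ b / (t + σ d)` on `U`, and likewise for `τ`, so `U` goes to infinity
at two distinct parameters. With constants subtracted, the forms satisfy the hyperbola equation `b'
z - b z' = (d' - d) z z'` (`PoleForm.relation_mem`). It has no nonconstant polynomial solutions, so
no polynomial parametrization exists. The expansions at the two poles give inequivalent branches
over `F`. A branch over `K` would give poles to both conjugate forms at once, because the powers of
`α` are independent over `K`, and then `z z'` could not be cancelled. Hence `d ∉ K` excludes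
statements 4, 5 and 7 (`Generates.not_lineLike`), and each of these makes `U` a line over `K`. -/

noncomputable section

namespace Hypercircle

open Polynomial

universe w

/-! ### Zariski closures of subsets of a line. -/

section Closure

variable {F : Type*} [Field F] {n : ℕ}

theorem vanishingIdeal_zeroLocus_vanishingIdeal (S : Set (Fin n → F)) :
    MvPolynomial.vanishingIdeal F (MvPolynomial.zeroLocus F (MvPolynomial.vanishingIdeal F S)) =
      MvPolynomial.vanishingIdeal F S :=
  le_antisymm
    (MvPolynomial.vanishingIdeal_anti_mono (MvPolynomial.zeroLocus_vanishingIdeal_le S))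
    (MvPolynomial.le_vanishingIdeal_zeroLocus _)

/-- The line in `Fⁿ` through `p` with direction `v`, where `p` and `v` have coordinates in `S`. -/
def baseLine {S : Type*} (F : Type*) [Field S] [Field F] [Algebra S F] {n : ℕ}
    (p v : Fin n → S) : Set (Fin n → F) :=
  {x | ∃ s : F, ∀ i, x i = algebraMap S F (p i) + s * algebraMap S F (v i)}

variable {S : Type*} [Field S] [Algebra S F]

/-- The polynomial `q` restricted to the line through `p` with direction `v`. -/
theorem aeval_line_poly (p v : Fin n → F) (q : MvPolynomial (Fin n) F) {A : Type*} [CommRing A]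
    [Algebra F A] (x : A) :
    MvPolynomial.aeval (fun i => algebraMap F A (p i) + x * algebraMap F A (v i)) q =
      Polynomial.aeval x (MvPolynomial.aeval (fun i => C (p i) + X * C (v i)) q) := by
  have : (MvPolynomial.aeval (fun i => algebraMap F A (p i) + x * algebraMap F A (v i)) :
      MvPolynomial (Fin n) F →ₐ[F] A) = (Polynomial.aeval x).comp
        (MvPolynomial.aeval (fun i => C (p i) + X * C (v i))) := by
    ext i; simp; ring
  rw [this]; rfl

theorem line_poly_eq_zero (p v : Fin n → F) (q : MvPolynomial (Fin n) F) {T : Set F}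
    (hT : T.Infinite) (h : ∀ s ∈ T, MvPolynomial.aeval (fun i => p i + s * v i) q = 0) :
    MvPolynomial.aeval (fun i => (C (p i) + X * C (v i) : F[X])) q = 0 := by
  refine Polynomial.eq_zero_of_infinite_isRoot _ (hT.mono fun s hs => ?_)
  have := aeval_line_poly p v q (A := F) s
  simp only [Algebra.algebraMap_self, RingHom.id_apply] at this
  rw [h s hs] at this
  simpa [Polynomial.IsRoot, Polynomial.aeval_def, Polynomial.eval₂_id] using this.symm

theorem line_relation_mem (p v : Fin n → S) (i j : Fin n) :
    (MvPolynomial.X i - MvPolynomial.C (algebraMap S F (p i))) *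
        MvPolynomial.C (algebraMap S F (v j)) -
      (MvPolynomial.X j - MvPolynomial.C (algebraMap S F (p j))) *
        MvPolynomial.C (algebraMap S F (v i)) ∈ MvPolynomial.vanishingIdeal F (baseLine F p v) := by
  rintro x ⟨s, hs⟩
  simp [hs]
  ring

/-- The linear relations between pairs of coordinates cut out the line, and a polynomial with
infinitely many zeros on the line vanishes on all of it. Infinitely many parameters suffice, so
points omitted by a rational parametrization do no harm. -/
theorem zeroLocus_vanishingIdeal_eq_baseLine (p v : Fin n → S) (hv : v ≠ 0) {W : Set (Fin n → F)}
    (hW : W ⊆ baseLine F p v) {T : Set F} (hT : T.Infinite)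
    (h : ∀ s ∈ T, (fun i => algebraMap S F (p i) + s * algebraMap S F (v i)) ∈ W) :
    MvPolynomial.zeroLocus F (MvPolynomial.vanishingIdeal F W) = baseLine F p v := by
  obtain ⟨j, hj⟩ := Function.ne_iff.mp hv
  have hj' : algebraMap S F (v j) ≠ 0 := by simpa using hj
  apply Set.Subset.antisymm
  · intro x hx
    refine ⟨(x j - algebraMap S F (p j)) / algebraMap S F (v j), fun i => ?_⟩
    have := hx _ (MvPolynomial.vanishingIdeal_anti_mono hW (line_relation_mem p v i j))
    simp at this
    field_simp
    linear_combination this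
  · rintro x ⟨s, hs⟩ q hq
    have h0 := line_poly_eq_zero (fun i => algebraMap S F (p i)) (fun i => algebraMap S F (v i)) q
      hT (fun s hs => hq _ (h s hs))
    have := aeval_line_poly (fun i => algebraMap S F (p i)) (fun i => algebraMap S F (v i)) q
      (A := F) s
    rw [h0] at this
    obtain rfl : x = _ := funext hs
    simpa using this

end Closure

/-! ### Common denominators and parametrizations of lines. -/

section ParamCurve

variable {S F : Type*} [Field S] [Field F] [Algebra S F] {n : ℕ}

/-- The points `N(t) / D(t)`, where `t` is not a zero of `D`. -/
def fracPoints (D : F[X]) (N : Fin n → F[X]) : Set (Fin n → F) :=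
  {x | ∃ t : F, D.eval t ≠ 0 ∧ ∀ i, x i = (N i).eval t / D.eval t}

/-- The product of the reduced denominators vanishes exactly where one of them does, so passing to
it excludes the same parameters. -/
theorem exists_paramCurve_eq (F : Type*) [Field F] [Algebra S F] (φ : Fin n → RatFunc S) :
    ∃ (D : S[X]) (N : Fin n → S[X]), D ≠ 0 ∧
      (∀ i, φ i = algebraMap S[X] (RatFunc S) (N i) / algebraMap S[X] (RatFunc S) D) ∧
      paramCurve F φ = MvPolynomial.zeroLocus F (MvPolynomial.vanishingIdeal F
        (fracPoints (D.map (algebraMap S F)) fun i => (N i).map (algebraMap S F))) := by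
  classical
  refine ⟨∏ i, (φ i).denom, fun i => (φ i).num * ∏ j ∈ Finset.univ.erase i, (φ j).denom,
    Finset.prod_ne_zero_iff.mpr fun i _ => (φ i).denom_ne_zero, fun i => ?_, ?_⟩
  · have h1 : algebraMap S[X] (RatFunc S) (∏ j ∈ Finset.univ.erase i, (φ j).denom) ≠ 0 :=
      RatFunc.algebraMap_ne_zero (Finset.prod_ne_zero_iff.mpr fun i _ => (φ i).denom_ne_zero)
    rw [← Finset.mul_prod_erase _ _ (Finset.mem_univ i), map_mul, map_mul,
      mul_div_mul_right _ _ h1, RatFunc.num_div_denom]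
  · unfold paramCurve fracPoints
    congr 2
    ext x
    refine exists_congr fun t => ?_
    rw [Polynomial.eval_map, Polynomial.eval₂_finsetProd, Finset.prod_ne_zero_iff]
    simp only [Finset.mem_univ, true_imp_iff]
    refine and_congr_right fun ht => forall_congr' fun i => ?_
    rw [← Finset.mul_prod_erase _ _ (Finset.mem_univ i), Polynomial.eval_map,
      Polynomial.eval₂_mul, Polynomial.eval₂_finsetProd,
      mul_div_mul_right _ _ (Finset.prod_ne_zero_iff.mpr fun i _ => ht i)]

theorem infinite_eval_ne_zero [CharZero F] {D : F[X]} (hD : D ≠ 0) :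
    {t : F | D.eval t ≠ 0}.Infinite := by
  have := (Polynomial.finite_setOfPred_isRoot hD).infinite_compl
  exact this

theorem paramCurve_linear [CharZero F] (p v : Fin n → S) (hv : v ≠ 0) (φ : Fin n → RatFunc S)
    (hφ : ∀ i, φ i = RatFunc.C (p i) + RatFunc.C (v i) * RatFunc.X) :
    paramCurve F φ = baseLine F p v := by
  obtain ⟨D, N, hD, hN, hU⟩ := exists_paramCurve_eq F φ
  have key : ∀ i, N i = (C (p i) + C (v i) * X) * D := fun i => by
    apply RatFunc.algebraMap_injective S
    have h := hN i
    rw [hφ, eq_div_iff (RatFunc.algebraMap_ne_zero hD)] at h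
    simpa using h.symm
  have hD' : D.map (algebraMap S F) ≠ 0 := (Polynomial.map_ne_zero_iff (algebraMap S F).injective).2 hD
  rw [hU]
  refine zeroLocus_vanishingIdeal_eq_baseLine p v hv ?_ (infinite_eval_ne_zero hD') ?_
  · rintro x ⟨t, ht, hx⟩
    refine ⟨t, fun i => ?_⟩
    rw [hx, div_eq_iff ht]
    simp only [key, Polynomial.map_mul, Polynomial.map_add, Polynomial.map_C, Polynomial.map_X,
      Polynomial.eval_mul, Polynomial.eval_add, Polynomial.eval_C, Polynomial.eval_X]
    ring
  · intro t ht
    refine ⟨t, ht, fun i => ?_⟩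
    rw [eq_div_iff ht]
    simp only [key, Polynomial.map_mul, Polynomial.map_add, Polynomial.map_C, Polynomial.map_X,
      Polynomial.eval_mul, Polynomial.eval_add, Polynomial.eval_C, Polynomial.eval_X]
    ring

theorem paramCurve_pole [CharZero F] (p v : Fin n → S) (hv : v ≠ 0) (k : S) (φ : Fin n → RatFunc S)
    (hφ : ∀ i, φ i = RatFunc.C (p i) + RatFunc.C (v i) / (RatFunc.X + RatFunc.C k)) :
    paramCurve F φ = baseLine F p v := by
  obtain ⟨D, N, hD, hN, hU⟩ := exists_paramCurve_eq F φ
  have hk : (RatFunc.X + RatFunc.C k : RatFunc S) ≠ 0 := by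
    have := RatFunc.algebraMap_ne_zero (Polynomial.X_add_C_ne_zero k)
    simpa using this
  have key : ∀ i, N i * (X + C k) = (C (p i) * (X + C k) + C (v i)) * D := fun i => by
    apply RatFunc.algebraMap_injective S
    have h := hN i
    have hD' := RatFunc.algebraMap_ne_zero hD
    rw [hφ] at h
    field_simp at h
    simp only [map_mul, map_add, RatFunc.algebraMap_X, RatFunc.algebraMap_C]
    linear_combination -h
  have key' : ∀ i (t : F), ((N i).map (algebraMap S F)).eval t * (t + algebraMap S F k) =
      (algebraMap S F (p i) * (t + algebraMap S F k) + algebraMap S F (v i)) *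
        (D.map (algebraMap S F)).eval t := fun i t => by
    have := congrArg (fun q => (q.map (algebraMap S F)).eval t) (key i)
    simpa using this
  have hD' : D.map (algebraMap S F) ≠ 0 := (Polynomial.map_ne_zero_iff (algebraMap S F).injective).2 hD
  -- As `v ≠ 0`, the pole `-k` is not cancelled, so it is a zero of any common denominator. The line
  -- parameter is then `(t + k)⁻¹`.
  have hpole : ∀ t, (D.map (algebraMap S F)).eval t ≠ 0 → t + algebraMap S F k ≠ 0 := by
    intro t ht h0
    apply hv
    funext i
    have := key' i t
    rw [h0] at this
    rw [mul_zero, mul_zero, zero_add, eq_comm, mul_eq_zero, or_iff_left ht] at this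
    simpa using this
  have point : ∀ t, (D.map (algebraMap S F)).eval t ≠ 0 → ∀ i,
      ((N i).map (algebraMap S F)).eval t / (D.map (algebraMap S F)).eval t =
        algebraMap S F (p i) + (t + algebraMap S F k)⁻¹ * algebraMap S F (v i) := by
    intro t ht i
    have h1 := hpole t ht
    rw [div_eq_iff ht]
    field_simp
    linear_combination key' i t
  rw [hU]
  refine zeroLocus_vanishingIdeal_eq_baseLine p v hv ?_
    ((infinite_eval_ne_zero hD').image (f := fun t => (t + algebraMap S F k)⁻¹) ?_) ?_
  · rintro x ⟨t, ht, hx⟩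
    exact ⟨_, fun i => (hx i).trans (point t ht i)⟩
  · intro s _ t _ h
    simpa using h
  · rintro _ ⟨t, ht, rfl⟩
    exact ⟨t, ht, fun i => (point t ht i).symm⟩

end ParamCurve

theorem X_add_C_ne_zero {L : Type*} [Field L] (d : L) :
    (RatFunc.X + RatFunc.C d : RatFunc L) ≠ 0 := by
  have := RatFunc.algebraMap_ne_zero (Polynomial.X_add_C_ne_zero d)
  simpa using this

/-! ### Units, their coordinates in powers of `α`, and conjugates. -/

section Generators

variable {K L : Type*} [Field K] [Field L] [Algebra K L]

theorem baseChange_algebraMap (q : K[X]) :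
    baseChange K L (algebraMap K[X] (RatFunc K) q) =
      algebraMap L[X] (RatFunc L) (q.map (algebraMap K L)) := by
  have := RatFunc.map_apply_div (φ := Polynomial.mapRingHom (algebraMap K L))
    (nonZeroDivisors_le_comap_nonZeroDivisors_of_injective _
      (Polynomial.map_injective _ (algebraMap K L).injective)) q 1
  simpa [baseChange, RatFunc.coe_mapRingHom_eq_coe_map] using this

theorem baseChange_C (a : K) :
    baseChange K L (RatFunc.C a) = RatFunc.C (algebraMap K L a) := by
  rw [← RatFunc.algebraMap_C, baseChange_algebraMap, Polynomial.map_C, RatFunc.algebraMap_C]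

theorem baseChange_X : baseChange K L RatFunc.X = RatFunc.X := by
  rw [← RatFunc.algebraMap_X, baseChange_algebraMap, Polynomial.map_X, RatFunc.algebraMap_X]

variable {F : Type*} [Field F] [Algebra K F]

/-- Common denominators for a hypercircle generated by a unit with a pole: the conjugates of the
unit are recovered from the coordinates. -/
theorem Generates.exists_pole_data {α : L} {a b d : L} {U : Set (Fin (Module.finrank K L) → F)}
    (h : Generates α (RatFunc.C a + RatFunc.C b / (RatFunc.X + RatFunc.C d)) U) :
    ∃ (D : F[X]) (N : Fin (Module.finrank K L) → F[X]), D ≠ 0 ∧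
      U = MvPolynomial.zeroLocus F (MvPolynomial.vanishingIdeal F (fracPoints D N)) ∧
      ∀ σ : L →ₐ[K] F, (∑ i : Fin (Module.finrank K L), C (σ (α ^ (i : ℕ))) * N i) * (X + C (σ d)) =
        (C (σ a) * (X + C (σ d)) + C (σ b)) * D := by
  obtain ⟨-, φ, hφ, rfl⟩ := h
  obtain ⟨D, N, hD, hN, hU⟩ := exists_paramCurve_eq F φ
  refine ⟨_, _, (Polynomial.map_ne_zero_iff (algebraMap K F).injective).2 hD, hU, fun σ => ?_⟩
  have hD' : algebraMap L[X] (RatFunc L) (D.map (algebraMap K L)) ≠ 0 :=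
    RatFunc.algebraMap_ne_zero ((Polynomial.map_ne_zero_iff (algebraMap K L).injective).2 hD)
  have h1 : (RatFunc.X + RatFunc.C d : RatFunc L) ≠ 0 := X_add_C_ne_zero d
  have key : (∑ i : Fin (Module.finrank K L), C (α ^ (i : ℕ)) * (N i).map (algebraMap K L)) * (X + C d) =
      (C a * (X + C d) + C b) * D.map (algebraMap K L) := by
    apply RatFunc.algebraMap_injective L
    simp only [hN, map_div₀, baseChange_algebraMap, div_mul_eq_mul_div] at hφ
    rw [← Finset.sum_div, eq_div_iff hD'] at hφ
    simp only [map_mul, map_sum, map_add, RatFunc.algebraMap_C, RatFunc.algebraMap_X]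
    simp only [mul_comm (RatFunc.C (α ^ _)), ← hφ]
    field_simp
  -- The coefficients of `D` and `N` come from `K`, so `σ` only moves `α`, `a`, `b` and `d`.
  have := congrArg (Polynomial.map (σ : L →+* F)) key
  simpa [Polynomial.map_map, Polynomial.map_sum] using this

variable [FiniteDimensional K L]

theorem linearIndependent_powers {α : L}
    (hα : IntermediateField.adjoin K {α} = ⊤) :
    LinearIndependent K fun i : Fin (Module.finrank K L) => α ^ (i : ℕ) := by
  rw [Field.primitive_element_iff_minpoly_natDegree_eq] at hα
  exact (linearIndependent_pow (K := K) α).comp (Fin.cast hα.symm) (Fin.cast_injective _)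

theorem sum_powers_eq_zero {α : L} (hα : IntermediateField.adjoin K {α} = ⊤)
    {c : Fin (Module.finrank K L) → K} (h : ∑ i, algebraMap K L (c i) * α ^ (i : ℕ) = 0) :
    c = 0 := by
  have hli := linearIndependent_powers hα
  rw [Fintype.linearIndependent_iff] at hli
  funext i
  exact hli c (by simpa only [Algebra.smul_def] using h) i

theorem exists_sum_powers {α : L} (hα : IntermediateField.adjoin K {α} = ⊤) (a : L) :
    ∃ c : Fin (Module.finrank K L) → K, a = ∑ i, algebraMap K L (c i) * α ^ (i : ℕ) := by
  have hspan := (linearIndependent_powers hα).span_eq_top_of_card_eq_finrank' (Fintype.card_fin _)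
  have ha : a ∈ Submodule.span K
      (Set.range fun i : Fin (Module.finrank K L) => α ^ (i : ℕ)) := hspan ▸ Submodule.mem_top
  obtain ⟨c, hc⟩ := (Submodule.mem_span_range_iff_exists_fun K).mp ha
  exact ⟨c, by simpa [Algebra.smul_def] using hc.symm⟩

/-- After clearing a common denominator, independence over `K` applies to the coefficients of each
power of the variable. -/
theorem sum_baseChange_eq_zero {α : L} (hα : IntermediateField.adjoin K {α} = ⊤)
    {φ : Fin (Module.finrank K L) → RatFunc K}
    (h : ∑ i, baseChange K L (φ i) * RatFunc.C (α ^ (i : ℕ)) = 0) : φ = 0 := by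
  obtain ⟨D, N, hD, hN, -⟩ := exists_paramCurve_eq K φ
  have hD' : algebraMap L[X] (RatFunc L) (D.map (algebraMap K L)) ≠ 0 :=
    RatFunc.algebraMap_ne_zero ((Polynomial.map_ne_zero_iff (algebraMap K L).injective).2 hD)
  have h1 : ∑ i, (N i).map (algebraMap K L) * C (α ^ (i : ℕ)) = 0 := by
    apply RatFunc.algebraMap_injective L
    rw [map_sum, map_zero]
    simp only [hN, map_div₀, baseChange_algebraMap, div_mul_eq_mul_div] at h
    rw [← Finset.sum_div, div_eq_zero_iff, or_iff_left hD'] at h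
    simpa only [map_mul, RatFunc.algebraMap_C] using h
  funext i
  have : N i = 0 := by
    ext m
    have h2 := congrArg (fun q => q.coeff m) h1
    simp only [Polynomial.finsetSum_coeff, Polynomial.coeff_mul_C, Polynomial.coeff_map,
      Polynomial.coeff_zero] at h2
    exact congrFun (sum_powers_eq_zero hα (c := fun i => (N i).coeff m) h2) i
  simp [hN, this]

theorem baseChange_coords_unique {α : L} (hα : IntermediateField.adjoin K {α} = ⊤)
    {φ ψ : Fin (Module.finrank K L) → RatFunc K}
    (h : ∑ i, baseChange K L (φ i) * RatFunc.C (α ^ (i : ℕ)) =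
      ∑ i, baseChange K L (ψ i) * RatFunc.C (α ^ (i : ℕ))) : φ = ψ := by
  rw [← sub_eq_zero]
  apply sum_baseChange_eq_zero hα
  simp only [Pi.sub_apply, map_sub, sub_mul, Finset.sum_sub_distrib, h, sub_self]

theorem IsCompUnit.cases {w : RatFunc L} (hw : IsCompUnit w) :
    (∃ a b : L, a ≠ 0 ∧ w = RatFunc.C b + RatFunc.C a * RatFunc.X) ∨
      ∃ a b d : L, b ≠ 0 ∧ w = RatFunc.C a + RatFunc.C b / (RatFunc.X + RatFunc.C d) := by
  obtain ⟨a, b, c, d, h, rfl⟩ := hw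
  by_cases hc : c = 0
  · subst hc
    have hd : d ≠ 0 := by rintro rfl; simp at h
    have ha : a ≠ 0 := by rintro rfl; simp at h
    refine Or.inl ⟨a / d, b / d, div_ne_zero ha hd, ?_⟩
    have : RatFunc.C d ≠ 0 := by simpa using hd
    simp only [map_zero, zero_mul, zero_add, map_div₀]
    field_simp
    ring
  -- Division of `a t + b` by `c t + d` with remainder.
  · refine Or.inr ⟨a / c, (b * c - a * d) / c ^ 2, d / c, ?_, ?_⟩
    · refine div_ne_zero (fun h' => h ?_) (pow_ne_zero _ hc)
      linear_combination -h'
    have hc' : RatFunc.C c ≠ 0 := by simpa using hc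
    have h1 : (RatFunc.X + RatFunc.C (d / c) : RatFunc L) ≠ 0 := X_add_C_ne_zero _
    have h4 : (RatFunc.C c * RatFunc.X + RatFunc.C d : RatFunc L) =
        RatFunc.C c * (RatFunc.X + RatFunc.C (d / c)) := by
      rw [mul_add, ← map_mul, mul_div_cancel₀ _ hc]
    have h5 : (RatFunc.C d : RatFunc L) = RatFunc.C c * RatFunc.C (d / c) := by
      rw [← map_mul, mul_div_cancel₀ _ hc]
    rw [h4]
    simp only [map_div₀ _ (b * c - a * d), map_div₀ _ a, map_sub, map_mul, map_pow, h5]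
    field_simp
    ring

theorem isCompUnit_linear {a b : L} (ha : a ≠ 0) :
    IsCompUnit (RatFunc.C b + RatFunc.C a * RatFunc.X) :=
  ⟨a, b, 0, 1, by simpa using ha, by simp [add_comm]⟩

theorem denom_pole {a b d : L} (hb : b ≠ 0) :
    (RatFunc.C a + RatFunc.C b / (RatFunc.X + RatFunc.C d) : RatFunc L).denom = X + C d := by
  have h1 : (RatFunc.X + RatFunc.C d : RatFunc L) ≠ 0 := X_add_C_ne_zero d
  have h2 : (RatFunc.C a + RatFunc.C b / (RatFunc.X + RatFunc.C d) : RatFunc L) =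
      algebraMap L[X] (RatFunc L) (C a * (X + C d) + C b) / algebraMap L[X] (RatFunc L) (X + C d) := by
    simp only [map_add, map_mul, RatFunc.algebraMap_C, RatFunc.algebraMap_X]
    field_simp
  have hcop : IsCoprime (C a * (X + C d) + C b : L[X]) (X + C d) := by
    refine ⟨C b⁻¹, -C b⁻¹ * C a, ?_⟩
    have : (C b⁻¹ * C b : L[X]) = 1 := by rw [← C_mul, inv_mul_cancel₀ hb, C_1]
    linear_combination this
  refine Polynomial.eq_of_monic_of_associated (RatFunc.monic_denom _) (monic_X_add_C d)
    (associated_of_dvd_dvd (h2 ▸ RatFunc.denom_div_dvd _ _) ?_)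
  refine hcop.symm.dvd_of_dvd_mul_left (Dvd.intro_left _
    ((RatFunc.num_mul_eq_mul_denom_iff (Polynomial.X_add_C_ne_zero d)).2 h2))

theorem not_isPoly_pole {a b d : L} (hb : b ≠ 0) :
    ¬ IsPoly (RatFunc.C a + RatFunc.C b / (RatFunc.X + RatFunc.C d) : RatFunc L) := by
  rintro ⟨p, hp⟩
  have := denom_pole (a := a) (d := d) hb
  rw [hp, RatFunc.denom_algebraMap] at this
  have := congrArg Polynomial.natDegree this
  simp at this

theorem generates_linear_iff [CharZero F] {α : L}
    (hα : IntermediateField.adjoin K {α} = ⊤) {a b : L} (ha : a ≠ 0)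
    {U : Set (Fin (Module.finrank K L) → F)} {p v : Fin (Module.finrank K L) → K}
    (hp : b = ∑ i, algebraMap K L (p i) * α ^ (i : ℕ))
    (hv : a = ∑ i, algebraMap K L (v i) * α ^ (i : ℕ)) :
    Generates α (RatFunc.C b + RatFunc.C a * RatFunc.X) U ↔ U = baseLine F p v := by
  have hv0 : v ≠ 0 := by rintro rfl; simp at hv; exact ha hv
  have hsum : (RatFunc.C b + RatFunc.C a * RatFunc.X : RatFunc L) = ∑ i,
      baseChange K L (RatFunc.C (p i) + RatFunc.C (v i) * RatFunc.X) * RatFunc.C (α ^ (i : ℕ)) := by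
    rw [hp, hv]
    simp only [map_sum, map_add, map_mul, baseChange_C, baseChange_X, Finset.sum_mul, add_mul,
      Finset.sum_add_distrib]
    congr 1
    exact Finset.sum_congr rfl fun i _ => by ring
  constructor
  · rintro ⟨-, φ, hφ, rfl⟩
    obtain rfl := baseChange_coords_unique hα (hφ.symm.trans hsum)
    exact paramCurve_linear p v hv0 _ fun i => rfl
  · rintro rfl
    exact ⟨isCompUnit_linear ha, _, hsum, (paramCurve_linear p v hv0 _ fun i => rfl).symm⟩

theorem Generates.eq_baseLine_of_pole [CharZero F] {α : L}
    (hα : IntermediateField.adjoin K {α} = ⊤) {a b : L} (hb : b ≠ 0) (k : K)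
    {U : Set (Fin (Module.finrank K L) → F)}
    (h : Generates α
      (RatFunc.C a + RatFunc.C b / (RatFunc.X + RatFunc.C (algebraMap K L k))) U) :
    ∃ p v : Fin (Module.finrank K L) → K, v ≠ 0 ∧ U = baseLine F p v := by
  obtain ⟨p, hp⟩ := exists_sum_powers hα a
  obtain ⟨v, hv⟩ := exists_sum_powers hα b
  have hv0 : v ≠ 0 := by rintro rfl; simp at hv; exact hb hv
  have hsum : (RatFunc.C a + RatFunc.C b / (RatFunc.X + RatFunc.C (algebraMap K L k)) :
      RatFunc L) = ∑ i, baseChange K L (RatFunc.C (p i) + RatFunc.C (v i) /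
        (RatFunc.X + RatFunc.C k)) * RatFunc.C (α ^ (i : ℕ)) := by
    rw [hp, hv]
    simp only [map_sum, map_add, map_mul, map_div₀, baseChange_C, baseChange_X, Finset.sum_div,
      add_mul, Finset.sum_add_distrib, div_mul_eq_mul_div]
  obtain ⟨-, φ, hφ, rfl⟩ := h
  obtain rfl := baseChange_coords_unique hα (hφ.symm.trans hsum)
  exact ⟨p, v, hv0, paramCurve_pole p v hv0 k _ fun i => rfl⟩

/-- The minimal polynomial of `d` has degree at least two and is separable in characteristic zero,
so it has two distinct roots in `F`; each is the image of `d` under an embedding of `L`. -/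
theorem exists_algHom_ne [CharZero K] [IsAlgClosed F] {d : L}
    (hd : ∀ k : K, d ≠ algebraMap K L k) : ∃ σ τ : L →ₐ[K] F, σ d ≠ τ d := by
  have hint : IsIntegral K d := Algebra.IsIntegral.isIntegral d
  have hdeg : (minpoly K d).natDegree ≠ 1 := fun h => by
    obtain ⟨k, hk⟩ := minpoly.mem_range_of_degree_eq_one K d
      ((Polynomial.degree_eq_iff_natDegree_eq (minpoly.ne_zero hint)).2 h)
    exact hd k hk.symm
  have hcard := Polynomial.card_rootSet_eq_natDegree (K := F) (minpoly.irreducible hint).separable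
    (IsAlgClosed.splits _)
  have hpos := minpoly.natDegree_pos hint
  obtain ⟨x, y, hxy⟩ := Fintype.one_lt_card_iff.mp (show 1 < Fintype.card _ by
    rw [hcard]; omega)
  have hr := Algebra.IsAlgebraic.range_eval_eq_rootSet_minpoly (F := K) (A := F) d
  obtain ⟨σ, hσ⟩ := hr.superset x.2
  obtain ⟨τ, hτ⟩ := hr.superset y.2
  refine ⟨σ, τ, fun h => hxy (Subtype.ext ?_)⟩
  rw [← hσ, ← hτ]
  exact h

end Generators

/-! ### Laurent series: orders under substitution. -/

theorem algebraMap_laurentSeries {F : Type*} [Field F] (r : F) :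
    algebraMap F (LaurentSeries F) r = HahnSeries.C r := by
  rw [HahnSeries.algebraMap_apply']
  exact HahnSeries.ofPowerSeries_C r

/-- The map on Laurent series induced by a ring homomorphism of the coefficients. -/
def laurentMap {S F : Type*} [Field S] [Field F] (f : S →+* F) :
    LaurentSeries S →+* LaurentSeries F where
  toFun x := x.map f
  map_one' := by
    ext m
    by_cases hm : m = 0 <;> simp [HahnSeries.coeff_one, hm]
  map_zero' := by ext m; simp
  map_add' x y := by ext m; simp
  map_mul' x y := HahnSeries.map_mul (f : S →ₙ+* F)

theorem map_eq_laurentMap {S F : Type*} [Field S] [Field F] (f : S →+* F) (x : LaurentSeries S) :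
    x.map f = laurentMap f x := rfl

theorem laurentMap_single {S F : Type*} [Field S] [Field F] (f : S →+* F) (k : ℤ) (r : S) :
    laurentMap f (HahnSeries.single k r) = HahnSeries.single k (f r) := by
  ext m
  rw [← map_eq_laurentMap]
  by_cases hm : m = k <;> simp [hm]

theorem laurentMap_C {S F : Type*} [Field S] [Field F] (f : S →+* F) (r : S) :
    laurentMap f (HahnSeries.C r) = HahnSeries.C (f r) :=
  laurentMap_single f 0 r

section LaurentOrder

variable {S : Type*} [Field S]

theorem exists_eq_X_pow_mul {f : PowerSeries S} (hf : f ≠ 0) :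
    ∃ g : PowerSeries S, PowerSeries.constantCoeff g ≠ 0 ∧
      f = PowerSeries.X ^ f.order.toNat * g := by
  obtain ⟨g, hg⟩ := PowerSeries.X_pow_order_dvd (φ := f)
  refine ⟨g, fun h0 => ?_, hg⟩
  have h := PowerSeries.coeff_order hf
  apply h
  generalize f.order.toNat = m at *
  rw [hg]
  simpa [PowerSeries.coeff_X_pow_mul'] using h0

theorem order_ofPowerSeries_of_constantCoeff_ne_zero {g : PowerSeries S}
    (hg : PowerSeries.constantCoeff g ≠ 0) : (HahnSeries.ofPowerSeries ℤ S g).order = 0 := by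
  have h0 : (HahnSeries.ofPowerSeries ℤ S g).coeff 0 ≠ 0 := by
    have := HahnSeries.ofPowerSeries_apply_coeff (Γ := ℤ) g 0
    rw [Nat.cast_zero] at this
    rw [this]
    simpa using hg
  have hne : HahnSeries.ofPowerSeries ℤ S g ≠ 0 := by
    intro h
    rw [h] at h0
    exact h0 rfl
  refine le_antisymm (HahnSeries.order_le_of_coeff_ne_zero h0) ?_
  rw [HahnSeries.le_order_iff_forall hne]
  intro j hj
  rw [PowerSeries.coeff_coe, if_pos hj]

theorem order_eq_zero_of_constantCoeff_ne_zero {g : PowerSeries S}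
    (hg : PowerSeries.constantCoeff g ≠ 0) : g.order = 0 :=
  PowerSeries.order_zero_of_unit (PowerSeries.isUnit_iff_constantCoeff.mpr hg.isUnit)

theorem order_ofPowerSeries (f : PowerSeries S) :
    (HahnSeries.ofPowerSeries ℤ S f).order = (f.order.toNat : ℤ) := by
  by_cases hf : f = 0
  -- Both sides are `0` by convention: `⊤.toNat = 0`, and the zero Hahn series has order `0`.
  · simp [hf]
  obtain ⟨g, hg, hfg⟩ := exists_eq_X_pow_mul hf
  have hg0 : HahnSeries.ofPowerSeries ℤ S g ≠ 0 := by
    rw [Ne, map_eq_zero_iff _ HahnSeries.ofPowerSeries_injective]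
    rintro rfl
    simp at hg
  conv_lhs => rw [hfg]
  rw [map_mul, HahnSeries.ofPowerSeries_X_pow, HahnSeries.order_mul (by simp) hg0,
    order_ofPowerSeries_of_constantCoeff_ne_zero hg, HahnSeries.order_single one_ne_zero]
  simp

theorem hasSubst_of_order {h : PowerSeries S} {m : ℕ} (hm : m ≠ 0) (hh : h.order = m) :
    PowerSeries.HasSubst h :=
  PowerSeries.HasSubst.of_constantCoeff_zero' (by
    rw [← PowerSeries.coeff_zero_eq_constantCoeff_apply]
    exact PowerSeries.coeff_of_lt_order 0 (by rw [hh]; exact_mod_cast Nat.pos_of_ne_zero hm))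

theorem constantCoeff_subst_eq {h : PowerSeries S} (hh : PowerSeries.constantCoeff h = 0)
    (g : PowerSeries S) :
    PowerSeries.constantCoeff (PowerSeries.subst h g) = PowerSeries.constantCoeff g := by
  have hs := PowerSeries.HasSubst.of_constantCoeff_zero' hh
  obtain ⟨g', hg'⟩ := PowerSeries.X_dvd_iff.mpr
    (show PowerSeries.constantCoeff (g - PowerSeries.C (PowerSeries.constantCoeff g)) = 0 by simp)
  have h1 : g = PowerSeries.C (PowerSeries.constantCoeff g) + PowerSeries.X * g' := by
    rw [← hg']; ring
  have h2 : PowerSeries.subst h g =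
      PowerSeries.C (PowerSeries.constantCoeff g) + h * PowerSeries.subst h g' := by
    conv_lhs => rw [h1]
    rw [PowerSeries.subst_add hs, PowerSeries.subst_mul hs, PowerSeries.subst_X hs,
      PowerSeries.subst_C]
    rfl
  rw [h2]
  simp [hh]

theorem constantCoeff_eq_zero_of_order {h : PowerSeries S} {m : ℕ} (hm : m ≠ 0)
    (hh : h.order = m) : PowerSeries.constantCoeff h = 0 := by
  rw [← PowerSeries.coeff_zero_eq_constantCoeff_apply]
  exact PowerSeries.coeff_of_lt_order 0 (by rw [hh]; exact_mod_cast Nat.pos_of_ne_zero hm)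

/-- For `f = X ^ r * g` with `g` a unit, substitution gives `h ^ r` times a series with the constant
term of `g`, again a unit. -/
theorem order_ofPowerSeries_subst {h : PowerSeries S} {m : ℕ} (hm : m ≠ 0) (hh : h.order = m)
    (f : PowerSeries S) :
    (HahnSeries.ofPowerSeries ℤ S (PowerSeries.subst h f)).order =
      m * (HahnSeries.ofPowerSeries ℤ S f).order := by
  have hs := hasSubst_of_order hm hh
  by_cases hf : f = 0
  · have : PowerSeries.subst h (0 : PowerSeries S) = 0 := by
      rw [← PowerSeries.coe_substAlgHom hs, map_zero]
    simp [hf, this]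
  obtain ⟨g, hg, hfg⟩ := exists_eq_X_pow_mul hf
  have hg' : PowerSeries.constantCoeff (PowerSeries.subst h g) ≠ 0 := by
    rwa [constantCoeff_subst_eq (constantCoeff_eq_zero_of_order hm hh)]
  have hg0 : HahnSeries.ofPowerSeries ℤ S (PowerSeries.subst h g) ≠ 0 := by
    rw [Ne, map_eq_zero_iff _ HahnSeries.ofPowerSeries_injective]
    intro h0
    rw [h0] at hg'
    simp at hg'
  have hh0 : HahnSeries.ofPowerSeries ℤ S h ≠ 0 := by
    rw [Ne, map_eq_zero_iff _ HahnSeries.ofPowerSeries_injective]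
    rintro rfl
    simp at hh
  rw [order_ofPowerSeries f]
  conv_lhs => rw [hfg]
  rw [PowerSeries.subst_mul hs, PowerSeries.subst_pow hs, PowerSeries.subst_X hs, map_mul, map_pow,
    HahnSeries.order_mul (pow_ne_zero _ hh0) hg0, HahnSeries.order_pow, order_ofPowerSeries h, hh,
    order_ofPowerSeries_of_constantCoeff_ne_zero hg']
  simp [mul_comm]

theorem order_of_subst {h : PowerSeries S} {m : ℕ} (hm : m ≠ 0) (hh : h.order = m)
    {x y : LaurentSeries S} {k : ℕ} {f : PowerSeries S}
    (hx : HahnSeries.ofPowerSeries ℤ S PowerSeries.X ^ k * x = HahnSeries.ofPowerSeries ℤ S f)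
    (hy : HahnSeries.ofPowerSeries ℤ S h ^ k * y =
      HahnSeries.ofPowerSeries ℤ S (PowerSeries.subst h f)) :
    y.order = m * x.order := by
  have hs := hasSubst_of_order hm hh
  have hh0 : HahnSeries.ofPowerSeries ℤ S h ≠ 0 := by
    rw [Ne, map_eq_zero_iff _ HahnSeries.ofPowerSeries_injective]
    rintro rfl
    simp at hh
  have hX0 : HahnSeries.ofPowerSeries ℤ S PowerSeries.X ≠ 0 := by simp
  by_cases hx0 : x = 0
  · subst hx0
    rw [mul_zero, eq_comm, map_eq_zero_iff _ HahnSeries.ofPowerSeries_injective] at hx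
    subst hx
    rw [← PowerSeries.coe_substAlgHom hs, map_zero, map_zero, mul_eq_zero,
      or_iff_right (pow_ne_zero _ hh0)] at hy
    simp [hy]
  have hord := order_ofPowerSeries_subst hm hh f
  have hf0 : f ≠ 0 := by
    rintro rfl
    rw [map_zero, mul_eq_zero, or_iff_right (pow_ne_zero _ hX0)] at hx
    exact hx0 hx
  have hy0 : y ≠ 0 := by
    rintro rfl
    obtain ⟨g, hg, hfg⟩ := exists_eq_X_pow_mul hf0
    rw [mul_zero, eq_comm, map_eq_zero_iff _ HahnSeries.ofPowerSeries_injective, hfg,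
      PowerSeries.subst_mul hs, PowerSeries.subst_pow hs, PowerSeries.subst_X hs, mul_eq_zero] at hy
    rcases hy with hy | hy
    · exact pow_ne_zero _ (fun h0 => hh0 (by rw [h0, map_zero])) hy
    · rw [← constantCoeff_subst_eq (constantCoeff_eq_zero_of_order hm hh), hy] at hg
      simp at hg
  rw [← hx, ← hy, HahnSeries.order_mul (pow_ne_zero _ hh0) hy0,
    HahnSeries.order_mul (pow_ne_zero _ hX0) hx0, HahnSeries.order_pow, HahnSeries.order_pow,
    order_ofPowerSeries h, hh, order_ofPowerSeries] at hord
  simp at hord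
  linarith

/-- Substitution commutes with linear forms. This makes the order of a linear form an invariant of
equivalence, and a value of `-1` a certificate of irreducibility. -/
theorem IsSubst.order_sum {n : ℕ} {ξ η : Fin n → LaurentSeries S} {h : PowerSeries S} {m : ℕ}
    (hm : m ≠ 0) (hh : h.order = m) (hs : IsSubst ξ h η) (c : Fin n → S) :
    (∑ i, HahnSeries.C (c i) * η i : LaurentSeries S).order = (m : ℤ) * (∑ i, HahnSeries.C (c i) * ξ i).order := by
  obtain ⟨k, f, hf, hf'⟩ := hs
  have hsub := hasSubst_of_order hm hh
  refine order_of_subst hm hh (k := k) (f := ∑ i, PowerSeries.C (c i) * f i) ?_ ?_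
  · rw [Finset.mul_sum, map_sum]
    refine Finset.sum_congr rfl fun i _ => ?_
    rw [map_mul, HahnSeries.ofPowerSeries_C, ← hf]
    ring
  · rw [Finset.mul_sum, ← PowerSeries.coe_substAlgHom hsub, map_sum, map_sum]
    refine Finset.sum_congr rfl fun i _ => ?_
    rw [PowerSeries.coe_substAlgHom hsub, PowerSeries.subst_mul hsub, PowerSeries.subst_C, map_mul]
    erw [HahnSeries.ofPowerSeries_C]
    rw [← hf']
    ring

theorem not_isReducible_of_order_sum {n : ℕ} {ξ : Fin n → LaurentSeries S} (c : Fin n → S)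
    (h : (∑ i, HahnSeries.C (c i) * ξ i : LaurentSeries S).order = -1) : ¬ IsReducible ξ := by
  rintro ⟨ζ, g, m, hm, hg, hs⟩
  rw [hs.order_sum (by omega) hg c] at h
  have : (m : ℤ) ∣ 1 := by
    rw [← Int.dvd_neg, ← h]
    exact Dvd.intro _ rfl
  have := Int.le_of_dvd one_pos this
  omega

theorem order_eq_neg_one {x : LaurentSeries S} {f : PowerSeries S}
    (hf : PowerSeries.constantCoeff f ≠ 0)
    (h : HahnSeries.ofPowerSeries ℤ S PowerSeries.X * x = HahnSeries.ofPowerSeries ℤ S f) :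
    x.order = -1 := by
  have hord := order_ofPowerSeries_of_constantCoeff_ne_zero hf
  have hx : x ≠ 0 := by
    rintro rfl
    rw [mul_zero, eq_comm, map_eq_zero_iff _ HahnSeries.ofPowerSeries_injective] at h
    subst h
    simp at hf
  rw [← h, HahnSeries.order_mul (by simp) hx, order_ofPowerSeries] at hord
  simp at hord
  omega

theorem order_nonneg_of_ofPowerSeries_mul {x : LaurentSeries S} {g f : PowerSeries S}
    (hg : PowerSeries.constantCoeff g ≠ 0)
    (h : HahnSeries.ofPowerSeries ℤ S g * x = HahnSeries.ofPowerSeries ℤ S f) :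
    0 ≤ x.order := by
  by_cases hx : x = 0
  · simp [hx]
  have hg0 : HahnSeries.ofPowerSeries ℤ S g ≠ 0 := by
    rw [Ne, map_eq_zero_iff _ HahnSeries.ofPowerSeries_injective]
    rintro rfl
    simp at hg
  have hord := order_ofPowerSeries f
  rw [← h, HahnSeries.order_mul hg0 hx, order_ofPowerSeries_of_constantCoeff_ne_zero hg] at hord
  omega

end LaurentOrder

/-! ### The unique branch of a line at infinity. -/

section LineBranches

variable {S F : Type*} [Field S] [Field F] [Algebra S F] {n : ℕ}

/-- The local parametrization `p + σ v` of a line. -/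
def lineParam (p v : Fin n → S) (σ : LaurentSeries S) (i : Fin n) : LaurentSeries S :=
  HahnSeries.C (p i) + σ * HahnSeries.C (v i)

/-- Substitution is tested on the reciprocals `σ⁻¹ = X * g` and `ρ⁻¹ = g'`, which are power series.
The order of `g'` is free, so the lemma serves both reducibility and equivalence. -/
theorem isSubst_lineParam (p v : Fin n → S) {g h g' : PowerSeries S} {σ ρ : LaurentSeries S}
    (hg : PowerSeries.constantCoeff g ≠ 0)
    (hσ : HahnSeries.ofPowerSeries ℤ S (PowerSeries.X * g) * σ = 1)
    (hρ : HahnSeries.ofPowerSeries ℤ S g' * ρ = 1) (hh : PowerSeries.HasSubst h)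
    (hc : PowerSeries.subst h (PowerSeries.X * g) = g') :
    IsSubst (lineParam p v σ) h (lineParam p v ρ) := by
  have h1 : g⁻¹ * g = 1 := PowerSeries.inv_mul_cancel _ hg
  refine ⟨1, fun i => PowerSeries.C (p i) * PowerSeries.X + PowerSeries.C (v i) * g⁻¹,
    fun i => ?_, fun i => ?_⟩
  · have h2 := congrArg (HahnSeries.ofPowerSeries ℤ S) h1
    simp only [map_mul, map_one] at h2 hσ
    simp only [lineParam, pow_one, map_add, map_mul, HahnSeries.ofPowerSeries_C]
    linear_combination (HahnSeries.ofPowerSeries ℤ S g⁻¹) * HahnSeries.C (v i) * hσ -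
      HahnSeries.ofPowerSeries ℤ S PowerSeries.X * σ * HahnSeries.C (v i) * h2
  · have h2 := congrArg (fun q => HahnSeries.ofPowerSeries ℤ S (PowerSeries.subst h q)) h1
    have h3 : PowerSeries.subst h (1 : PowerSeries S) = 1 := by
      rw [← PowerSeries.coe_substAlgHom hh, map_one]
    have hC : ∀ r : S, PowerSeries.subst h (PowerSeries.C r) = PowerSeries.C r :=
      fun r => PowerSeries.subst_C r
    rw [← hc] at hρ
    simp only [PowerSeries.subst_mul hh, PowerSeries.subst_X hh, h3, map_mul, map_one] at h2 hρ
    simp only [lineParam, pow_one, map_add, map_mul, PowerSeries.subst_add hh,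
      PowerSeries.subst_mul hh, PowerSeries.subst_X hh, hC, HahnSeries.ofPowerSeries_C]
    linear_combination HahnSeries.ofPowerSeries ℤ S (PowerSeries.subst h g⁻¹) *
      HahnSeries.C (v i) * hρ - HahnSeries.ofPowerSeries ℤ S h * ρ * HahnSeries.C (v i) * h2

theorem exists_subst_eq {g g' : PowerSeries S} (hg : PowerSeries.constantCoeff g ≠ 0)
    (hg' : g'.order = 1) : ∃ h : PowerSeries S, h.order = 1 ∧
      PowerSeries.subst h (PowerSeries.X * g) = g' := by
  have h1 : PowerSeries.coeff 1 (PowerSeries.X * g) = PowerSeries.constantCoeff g := by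
    rw [show 1 = 0 + 1 from rfl, PowerSeries.coeff_succ_X_mul]
    simp
  have hu : IsUnit (PowerSeries.coeff 1 (PowerSeries.X * g)) := by
    rw [h1]
    exact hg.isUnit
  set r := PowerSeries.substInvOfIsUnit (PowerSeries.X * g) hu with hr
  have hg1 : g'.order = (1 : ℕ) := by simpa using hg'
  have hs := hasSubst_of_order one_ne_zero hg1
  have hr1 : r.order = (1 : ℕ) := by
    rw [PowerSeries.order_eq_nat]
    refine ⟨?_, fun i hi => ?_⟩
    · rw [hr, PowerSeries.coeff_one_substInvOfIsUnit]
      exact Units.ne_zero _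
    · obtain rfl : i = 0 := by omega
      simp [hr]
  have hX : PowerSeries.subst r (PowerSeries.X * g) = PowerSeries.X :=
    PowerSeries.subst_substInvOfIsUnit_right _ (by simp) hu
  -- `r` is the compositional inverse of `X * g`, so `r(g')` is sent to `g'`.
  refine ⟨PowerSeries.subst g' r, ?_, ?_⟩
  · have := order_ofPowerSeries_subst one_ne_zero hg1 r
    rw [order_ofPowerSeries, order_ofPowerSeries, hr1] at this
    simp at this
    exact this
  · rw [← PowerSeries.subst_comp_subst_apply (hasSubst_of_order one_ne_zero hr1) hs, hX,
      PowerSeries.subst_X hs]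

theorem coeff_lineParam {p v : Fin n → S} {σ : LaurentSeries S} {m : ℤ} (hm : m < 0) (i : Fin n) :
    (lineParam p v σ i).coeff m = σ.coeff m * v i := by
  simp [lineParam, HahnSeries.C_apply, HahnSeries.coeff_single_of_ne hm.ne]

theorem eq_lineParam {p v : Fin n → S} {j : Fin n} (hj : v j ≠ 0) {ξ : Fin n → LaurentSeries S}
    (h : ∀ q ∈ MvPolynomial.vanishingIdeal F (baseLine F p v),
      MvPolynomial.aeval (fun i => (ξ i).map (algebraMap S F)) q = 0) :
    ξ = lineParam p v ((ξ j - HahnSeries.C (p j)) * HahnSeries.C (v j)⁻¹) := by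
  have key : ∀ i, (ξ i - HahnSeries.C (p i)) * HahnSeries.C (v j) =
      (ξ j - HahnSeries.C (p j)) * HahnSeries.C (v i) := fun i => by
    apply (laurentMap (algebraMap S F)).injective
    have h1 := h _ (line_relation_mem p v i j)
    simp only [map_sub, map_mul, MvPolynomial.aeval_X, MvPolynomial.aeval_C, map_eq_laurentMap,
      algebraMap_laurentSeries] at h1
    simpa only [map_sub, map_mul, laurentMap_C, sub_eq_zero] using h1
  funext i
  have h1 : (HahnSeries.C (v j)⁻¹ * HahnSeries.C (v j) : LaurentSeries S) = 1 := by
    rw [← map_mul, inv_mul_cancel₀ hj, map_one]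
  rw [lineParam]
  linear_combination HahnSeries.C (v j)⁻¹ * key i - (ξ i - HahnSeries.C (p i)) * h1

theorem single_neg_one_mul :
    HahnSeries.ofPowerSeries ℤ S (PowerSeries.X * 1) * HahnSeries.single (-1) 1 = 1 := by
  simp [HahnSeries.single_mul_single]

theorem IsParamAtInfinity.exists_lineParam {p v : Fin n → S} (hv : v ≠ 0)
    {ξ : Fin n → LaurentSeries S} (h : IsParamAtInfinity (baseLine F p v) ξ) :
    ∃ (g : PowerSeries S) (σ : LaurentSeries S), PowerSeries.constantCoeff g ≠ 0 ∧
      HahnSeries.ofPowerSeries ℤ S (PowerSeries.X * g) * σ = 1 ∧ ξ = lineParam p v σ := by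
  obtain ⟨j, hj⟩ := Function.ne_iff.mp hv
  have hξ := eq_lineParam hj h.equations
  generalize (ξ j - HahnSeries.C (p j)) * HahnSeries.C (v j)⁻¹ = σ at hξ
  subst hξ
  obtain ⟨i, hi⟩ := h.pole
  have hne : lineParam p v σ i ≠ 0 := by
    intro h0
    simp [h0] at hi
  have hco := HahnSeries.coeff_order_eq_zero.not.mpr hne
  rw [coeff_lineParam hi] at hco
  have hσ := (HahnSeries.order_le_of_coeff_ne_zero (left_ne_zero_of_mul hco)).trans_lt hi
  have hσ0 : σ ≠ 0 := by
    rintro rfl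
    simp at hσ
  have hinv : σ⁻¹.order = -σ.order := by
    have := HahnSeries.order_mul hσ0 (inv_ne_zero hσ0)
    rw [mul_inv_cancel₀ hσ0, HahnSeries.order_one] at this
    omega
  obtain ⟨m, hm⟩ := Int.eq_ofNat_of_zero_le (show 0 ≤ σ⁻¹.order by omega)
  have hps := LaurentSeries.X_order_mul_powerSeriesPart hm.symm
  have hg : PowerSeries.constantCoeff σ⁻¹.powerSeriesPart ≠ 0 := by
    rw [← PowerSeries.coeff_zero_eq_constantCoeff_apply, LaurentSeries.powerSeriesPart_coeff]
    simpa using inv_ne_zero hσ0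
  generalize σ⁻¹.powerSeriesPart = g at hps hg
  have hmul : HahnSeries.ofPowerSeries ℤ S (PowerSeries.X ^ m * g) * σ = 1 := by
    rw [hps, inv_mul_cancel₀ hσ0]
  have horder : (PowerSeries.X ^ m * g : PowerSeries S).order = (m : ℕ∞) := by
    rw [PowerSeries.order_mul, PowerSeries.order_X_pow, order_eq_zero_of_constantCoeff_ne_zero hg]
    simp
  -- `m` is the pole order of `σ`, hence positive. If `m ≥ 2`, the series arises from `p + s⁻¹ v` by
  -- substituting `X ^ m * g`, against irreducibility.
  have hm1 : m = 1 := by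
    by_contra hm1
    have hm2 : 2 ≤ m := by omega
    have hs := hasSubst_of_order (by omega) horder
    refine h.irreducible ⟨lineParam p v (HahnSeries.single (-1) 1), _, m, hm2, horder,
      isSubst_lineParam p v (by simp) single_neg_one_mul hmul hs ?_⟩
    rw [mul_one, PowerSeries.subst_X hs]
  subst hm1
  rw [pow_one] at hmul
  exact ⟨g, σ, hg, hmul, rfl⟩

theorem oneBranchAtInfinity_baseLine [CharZero F] {p v : Fin n → S} (hv : v ≠ 0) :
    OneBranchAtInfinity S (baseLine F p v) := by
  refine ⟨⟨lineParam p v (HahnSeries.single (-1) 1), ?_, ?_, ?_⟩, fun ξ η hξ hη => ?_⟩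
  · intro q hq
    have h0 := line_poly_eq_zero (fun i => algebraMap S F (p i)) (fun i => algebraMap S F (v i)) q
      Set.infinite_univ (fun s _ => hq _ ⟨s, fun i => rfl⟩)
    have h1 := aeval_line_poly (fun i => algebraMap S F (p i)) (fun i => algebraMap S F (v i)) q
      (A := LaurentSeries F) (HahnSeries.single (-1) 1)
    rw [h0, map_zero] at h1
    rw [← h1]
    congr 2
    funext i
    rw [map_eq_laurentMap, lineParam, map_add, map_mul, laurentMap_C, laurentMap_C,
      laurentMap_single, map_one, algebraMap_laurentSeries, algebraMap_laurentSeries]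
  · obtain ⟨j, hj⟩ := Function.ne_iff.mp hv
    refine ⟨j, lt_of_le_of_lt (HahnSeries.order_le_of_coeff_ne_zero (g := -1) ?_) (by norm_num)⟩
    rw [coeff_lineParam (by norm_num)]
    simpa using hj
  · obtain ⟨j, hj⟩ := Function.ne_iff.mp hv
    refine not_isReducible_of_order_sum (Pi.single j 1) ?_
    rw [Finset.sum_eq_single j (fun i _ hi => by simp [hi]) (by simp), Pi.single_eq_same, map_one,
      one_mul]
    refine order_eq_neg_one (f := PowerSeries.C (p j) * PowerSeries.X + PowerSeries.C (v j))
      (by simpa using hj) ?_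
    have := single_neg_one_mul (S := S)
    rw [mul_one] at this
    simp only [lineParam, map_add, map_mul, HahnSeries.ofPowerSeries_C]
    linear_combination HahnSeries.C (v j) * this
  · obtain ⟨g, σ, hg, hσ, rfl⟩ := hξ.exists_lineParam hv
    obtain ⟨g', ρ, hg', hρ, rfl⟩ := hη.exists_lineParam hv
    obtain ⟨h, hh, hc⟩ := exists_subst_eq (g' := PowerSeries.X * g') hg (by
      rw [PowerSeries.order_mul, PowerSeries.order_X, order_eq_zero_of_constantCoeff_ne_zero hg']
      simp)
    exact ⟨h, hh, isSubst_lineParam p v hg hσ hρ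
      (hasSubst_of_order one_ne_zero (by simpa using hh)) hc⟩

end LineBranches

/-! ### Equations of a rationally parametrized curve, evaluated in extension fields. -/

section FracPoints

variable {F : Type w} [Field F] {n : ℕ}

/-- `Q` is chosen before `A` and `ψ`: evaluation at points of `F` shows `Q = 0`, and the same `Q`
then controls Laurent expansions. -/
theorem exists_clear_denom (D : F[X]) (N : Fin n → F[X]) (q : MvPolynomial (Fin n) F) :
    ∃ (m : ℕ) (Q : F[X]), ∀ (A : Type w) [Field A] [Algebra F A] (ψ : F[X] →ₐ[F] A), ψ D ≠ 0 →
      MvPolynomial.aeval (fun i => ψ (N i) / ψ D) q * ψ D ^ m = ψ Q := by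
  induction q using MvPolynomial.induction_on with
  | C a =>
    refine ⟨0, C a, fun A _ _ ψ _ => ?_⟩
    have : ψ (C a) = algebraMap F A a := ψ.commutes a
    simp [this]
  | add p q hp hq =>
    obtain ⟨m, P, hP⟩ := hp
    obtain ⟨k, Q, hQ⟩ := hq
    refine ⟨m + k, P * D ^ k + Q * D ^ m, fun A _ _ ψ hD => ?_⟩
    simp only [map_add, map_mul, map_pow, ← hP A ψ hD, ← hQ A ψ hD]
    ring
  | mul_X p i hp =>
    obtain ⟨m, P, hP⟩ := hp
    refine ⟨m + 1, P * N i, fun A _ _ ψ hD => ?_⟩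
    rw [map_mul, map_mul, MvPolynomial.aeval_X, ← hP A ψ hD]
    field_simp
    ring

theorem aeval_frac_eq_zero [CharZero F] {D : F[X]} {N : Fin n → F[X]} {q : MvPolynomial (Fin n) F}
    (hq : q ∈ MvPolynomial.vanishingIdeal F (fracPoints D N)) {A : Type w} [Field A] [Algebra F A]
    (ψ : F[X] →ₐ[F] A) (hψ : ψ D ≠ 0) :
    MvPolynomial.aeval (fun i => ψ (N i) / ψ D) q = 0 := by
  have hD : D ≠ 0 := by
    rintro rfl
    simp at hψ
  obtain ⟨m, Q, hQ⟩ := exists_clear_denom D N q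
  have hQ0 : Q = 0 := by
    refine Polynomial.eq_zero_of_infinite_isRoot _ ((infinite_eval_ne_zero hD).mono fun t ht => ?_)
    have h1 := hQ F (Polynomial.aeval t) (by simpa [Polynomial.aeval_def] using ht)
    rw [hq _ ⟨t, ht, fun i => by simp [Polynomial.coe_aeval_eq_eval]⟩, zero_mul] at h1
    simpa [Polynomial.IsRoot, Polynomial.coe_aeval_eq_eval] using h1.symm
  have := hQ A ψ hψ
  rw [hQ0, map_zero, mul_eq_zero, or_iff_left (pow_ne_zero _ hψ)] at this
  exact this

theorem paramCurve_polynomial {S : Type*} [Field S] [Algebra S F] (P : Fin n → S[X]) :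
    paramCurve F (fun i => algebraMap S[X] (RatFunc S) (P i)) =
      MvPolynomial.zeroLocus F (MvPolynomial.vanishingIdeal F
        {x | ∃ t : F, ∀ i, x i = ((P i).map (algebraMap S F)).eval t}) := by
  simp [paramCurve, Polynomial.eval₂_one, Polynomial.eval_map]

theorem PolyParametrizable.of_algebra {S : Type*} [Field S] [Algebra S F] {U : Set (Fin n → F)}
    (h : PolyParametrizable S U) : PolyParametrizable F U := by
  obtain ⟨P, rfl⟩ := h
  refine ⟨fun i => (P i).map (algebraMap S F), ?_⟩
  rw [paramCurve_polynomial, paramCurve_polynomial]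
  simp

theorem polyParametrizable_baseLine [CharZero F] {S : Type*} [Field S] [Algebra S F]
    {p v : Fin n → S} (hv : v ≠ 0) : PolyParametrizable S (baseLine F p v) :=
  ⟨fun i => C (p i) + C (v i) * X, (paramCurve_linear p v hv _ fun i => by simp).symm⟩

end FracPoints

/-! ### Curves with two linear forms having distinct poles. -/

section PoleForm

variable {F : Type w} [Field F] {n : ℕ}

/-- The linear form with coefficients `c` takes the value `a + b / (t + d)` at `N(t) / D(t)`. -/
structure PoleForm (D : F[X]) (N : Fin n → F[X]) (c : Fin n → F) (a b d : F) : Prop where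
  ne_zero : b ≠ 0
  eq : (∑ i, C (c i) * N i) * (X + C d) = (C a * (X + C d) + C b) * D

/-- The linear form with coefficients `c`, minus the constant `a`. -/
def affineForm (c : Fin n → F) (a : F) : MvPolynomial (Fin n) F :=
  ∑ i, MvPolynomial.C (c i) * MvPolynomial.X i - MvPolynomial.C a

theorem aeval_affineForm {A : Type*} [CommRing A] [Algebra F A] (c : Fin n → F) (a : F)
    (x : Fin n → A) : MvPolynomial.aeval x (affineForm c a) =
      ∑ i, algebraMap F A (c i) * x i - algebraMap F A a := by
  simp [affineForm]

variable {D : F[X]} {N : Fin n → F[X]} {c c' : Fin n → F} {a b d a' b' d' : F}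

theorem PoleForm.eval (h : PoleForm D N c a b d) {t : F} (ht : D.eval t ≠ 0) {x : Fin n → F}
    (hx : ∀ i, x i = (N i).eval t / D.eval t) :
    MvPolynomial.aeval x (affineForm c a) * (t + d) = b := by
  have h1 := congrArg (Polynomial.eval t) h.eq
  simp only [Polynomial.eval_mul, Polynomial.eval_add, Polynomial.eval_finsetSum,
    Polynomial.eval_C, Polynomial.eval_X] at h1
  have h2 : ∑ i, c i * x i = (∑ i, c i * (N i).eval t) / D.eval t := by
    simp only [hx, Finset.sum_div, mul_div_assoc]
  rw [aeval_affineForm]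
  simp only [Algebra.algebraMap_self, RingHom.id_apply]
  rw [h2]
  field_simp
  linear_combination h1

theorem PoleForm.relation_mem (h : PoleForm D N c a b d) (h' : PoleForm D N c' a' b' d') :
    MvPolynomial.C b' * affineForm c a - MvPolynomial.C b * affineForm c' a' -
      MvPolynomial.C (d' - d) * affineForm c a * affineForm c' a' ∈
        MvPolynomial.vanishingIdeal F (fracPoints D N) := by
  rintro x ⟨t, ht, hx⟩
  have h1 := h.eval ht hx
  have h2 := h'.eval ht hx
  simp only [map_sub, map_mul, MvPolynomial.aeval_C, Algebra.algebraMap_self, RingHom.id_apply]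
  rw [← h1, ← h2]
  ring

theorem not_polyParametrizable [CharZero F] (h : PoleForm D N c a b d)
    (h' : PoleForm D N c' a' b' d') (hd : d ≠ d') (hD : D ≠ 0) :
    ¬ PolyParametrizable F
      (MvPolynomial.zeroLocus F (MvPolynomial.vanishingIdeal F (fracPoints D N))) := by
  rintro ⟨P, hP⟩
  rw [paramCurve_polynomial] at hP
  have hI := congrArg (MvPolynomial.vanishingIdeal F) hP
  rw [vanishingIdeal_zeroLocus_vanishingIdeal, vanishingIdeal_zeroLocus_vanishingIdeal] at hI
  have evalP : ∀ (q : MvPolynomial (Fin n) F) (t : F),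
      (MvPolynomial.aeval P q).eval t = MvPolynomial.aeval (fun i => (P i).eval t) q := by
    intro q t
    rw [← Polynomial.coe_aeval_eq_eval, ← AlgHom.comp_apply]
    congr 1
    ext i
    simp
  have key := h.relation_mem h'
  rw [hI] at key
  have hP0 := Polynomial.funext (q := 0) (fun t => by
    rw [evalP, key _ ⟨t, fun i => by simp⟩, Polynomial.eval_zero])
  simp only [map_sub, map_mul, MvPolynomial.aeval_C, Polynomial.algebraMap_eq] at hP0
  -- The hyperbola equation, multiplied by `d' - d`, factors with a nonzero constant on the right.
  -- Its factors are therefore constant polynomials, although the form takes the nonconstant value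
  -- `b / (t + d)` on the curve.
  have hunit : (C (d' - d) * MvPolynomial.aeval P (affineForm c a) + C b) *
      (C (d' - d) * MvPolynomial.aeval P (affineForm c' a') - C b') = C (-(b * b')) := by
    simp only [C_sub, C_neg, C_mul] at hP0 ⊢
    linear_combination -(C d' - C d) * hP0
  have hu := isUnit_of_mul_isUnit_left (hunit ▸ Polynomial.isUnit_C.mpr
    (neg_ne_zero.mpr (mul_ne_zero h.ne_zero h'.ne_zero)).isUnit)
  obtain ⟨e, -, he⟩ := Polynomial.isUnit_iff.mp hu
  have hdd : d' - d ≠ 0 := sub_ne_zero.mpr hd.symm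
  have hconst : MvPolynomial.C (d' - d) * affineForm c a + MvPolynomial.C b - MvPolynomial.C e ∈
      MvPolynomial.vanishingIdeal F (fracPoints D N) := by
    rw [hI]
    rintro x ⟨t, hx⟩
    obtain rfl : x = fun i => (P i).eval t := funext fun i => by simpa using hx i
    have h1 := congrArg (Polynomial.eval t) he
    simp only [Polynomial.eval_add, Polynomial.eval_mul, Polynomial.eval_C, evalP] at h1
    simp only [map_sub, map_add, map_mul, MvPolynomial.aeval_C, Algebra.algebraMap_self,
      RingHom.id_apply]
    linear_combination -h1
  have hlin : C (d' - d) * C b + C (b - e) * (X + C d) = 0 := by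
    refine Polynomial.eq_zero_of_infinite_isRoot _ ((infinite_eval_ne_zero hD).mono fun t ht => ?_)
    have h1 := h.eval ht (x := fun i => (N i).eval t / D.eval t) fun i => rfl
    have h2 := hconst (fun i => (N i).eval t / D.eval t) ⟨t, ht, fun i => rfl⟩
    simp only [map_sub, map_add, map_mul, MvPolynomial.aeval_C, Algebra.algebraMap_self,
      RingHom.id_apply] at h2
    simp only [Set.mem_ofPred_eq, Polynomial.IsRoot, Polynomial.eval_add, Polynomial.eval_mul,
      Polynomial.eval_C, Polynomial.eval_X]
    linear_combination (t + d) * h2 - (d' - d) * h1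
  have h3 := congrArg (Polynomial.eval (-d)) hlin
  simp [hdd, h.ne_zero] at h3

/-- Expansion of a polynomial at `e`, as a Laurent series. -/
def expandAt (e : F) : F[X] →ₐ[F] LaurentSeries F where
  toRingHom := (HahnSeries.ofPowerSeries ℤ F).comp
    (Polynomial.coeToPowerSeries.ringHom.comp (Polynomial.taylorAlgHom e : F[X] →+* F[X]))
  commutes' r := by
    rw [algebraMap_laurentSeries]
    simp [Polynomial.algebraMap_eq]

theorem expandAt_apply (e : F) (p : F[X]) :
    expandAt e p = HahnSeries.ofPowerSeries ℤ F (Polynomial.taylor e p : F[X]) := rfl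

theorem expandAt_ne_zero {p : F[X]} (hp : p ≠ 0) (e : F) : expandAt e p ≠ 0 := by
  rw [expandAt_apply, Ne, map_eq_zero_iff _ HahnSeries.ofPowerSeries_injective,
    Polynomial.coe_eq_zero_iff]
  exact fun h => hp (Polynomial.taylor_injective e (by rw [h, map_zero]))

/-- The local parametrization `N / D` at the parameter value `e`. -/
def expansion (D : F[X]) (N : Fin n → F[X]) (e : F) (i : Fin n) : LaurentSeries F :=
  expandAt e (N i) / expandAt e D

/-- Expansion at `e` replaces `t` by `s + e`; the form thus has a simple pole if `e = -d` and none
otherwise. -/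
theorem PoleForm.expansion (h : PoleForm D N c a b d) (hD : D ≠ 0) (e : F) :
    HahnSeries.ofPowerSeries ℤ F (PowerSeries.X + PowerSeries.C (e + d)) *
      ∑ i, HahnSeries.C (c i) * expansion D N e i =
    HahnSeries.ofPowerSeries ℤ F
      (PowerSeries.C a * (PowerSeries.X + PowerSeries.C (e + d)) + PowerSeries.C b) := by
  have hD' := expandAt_ne_zero hD e
  have hC : ∀ r : F, expandAt e (C r) = HahnSeries.C r := fun r =>
    (AlgHom.commutes (expandAt e) r).trans (algebraMap_laurentSeries r)
  have hX : expandAt e (X + C d) =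
      HahnSeries.ofPowerSeries ℤ F (PowerSeries.X + PowerSeries.C (e + d)) := by
    rw [expandAt_apply]
    simp [add_assoc]
  have h1 := congrArg (expandAt e) h.eq
  simp only [map_mul, map_sum, map_add _ _ (C b), hC, hX] at h1
  have h2 : ∑ i, HahnSeries.C (c i) * Hypercircle.expansion D N e i =
      (∑ i, HahnSeries.C (c i) * expandAt e (N i)) / expandAt e D := by
    simp only [Hypercircle.expansion, Finset.sum_div, mul_div_assoc]
  rw [h2, mul_div_assoc', div_eq_iff hD', mul_comm, h1, map_add _ (_ * _), map_mul,
    HahnSeries.ofPowerSeries_C, HahnSeries.ofPowerSeries_C]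

theorem PoleForm.order_expansion (h : PoleForm D N c a b d) (hD : D ≠ 0) :
    (∑ i, HahnSeries.C (c i) * Hypercircle.expansion D N (-d) i : LaurentSeries F).order = -1 := by
  have := h.expansion hD (-d)
  rw [neg_add_cancel, map_zero, add_zero] at this
  exact order_eq_neg_one (by simpa using h.ne_zero) this

theorem PoleForm.order_expansion_nonneg (h : PoleForm D N c a b d) (hD : D ≠ 0) {e : F}
    (he : e + d ≠ 0) :
    0 ≤ (∑ i, HahnSeries.C (c i) * Hypercircle.expansion D N e i : LaurentSeries F).order :=
  order_nonneg_of_ofPowerSeries_mul (by simpa using he) (h.expansion hD e)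

theorem PoleForm.isParamAtInfinity [CharZero F] (h : PoleForm D N c a b d) (hD : D ≠ 0) :
    IsParamAtInfinity
      (MvPolynomial.zeroLocus F (MvPolynomial.vanishingIdeal F (fracPoints D N)))
      (Hypercircle.expansion D N (-d)) := by
  have hord := h.order_expansion hD
  refine ⟨fun q hq => ?_, ?_, not_isReducible_of_order_sum c hord⟩
  · rw [vanishingIdeal_zeroLocus_vanishingIdeal] at hq
    have := aeval_frac_eq_zero hq (expandAt (-d)) (expandAt_ne_zero hD _)
    have hid : (fun i => (Hypercircle.expansion D N (-d) i).map (algebraMap F F)) =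
        fun i => expandAt (-d) (N i) / expandAt (-d) D := by
      funext i
      ext m
      simp [Hypercircle.expansion]
    rw [hid]
    exact this
  · by_contra! hno
    have hne : (∑ i, HahnSeries.C (c i) * Hypercircle.expansion D N (-d) i : LaurentSeries F) ≠ 0 := by
      intro h0
      rw [h0, HahnSeries.order_zero] at hord
      omega
    refine HahnSeries.coeff_order_eq_zero.not.mpr hne ?_
    rw [hord, HahnSeries.coeff_sum]
    refine Finset.sum_eq_zero fun i _ => ?_
    rw [HahnSeries.C_mul_eq_smul, HahnSeries.coeff_smul,
      HahnSeries.coeff_eq_zero_of_lt_order (lt_of_lt_of_le (by norm_num) (hno i)), smul_zero]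

/-- The form `c` has order `-1` on the expansion at `-d` and nonnegative order at `-d'`; equivalence
preserves this order. -/
theorem not_oneBranchAtInfinity [CharZero F] (h : PoleForm D N c a b d)
    (h' : PoleForm D N c' a' b' d') (hd : d ≠ d') (hD : D ≠ 0) :
    ¬ OneBranchAtInfinity F
      (MvPolynomial.zeroLocus F (MvPolynomial.vanishingIdeal F (fracPoints D N))) := by
  rintro ⟨-, huniq⟩
  obtain ⟨g, hg, hs⟩ := huniq _ _ (h'.isParamAtInfinity hD) (h.isParamAtInfinity hD)
  have h1 := hs.order_sum one_ne_zero (by simpa using hg) c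
  rw [h.order_expansion hD] at h1
  have h2 := h.order_expansion_nonneg hD (e := -d') (by rw [neg_add_eq_sub]; exact sub_ne_zero.mpr hd)
  rw [Nat.cast_one, one_mul] at h1
  omega

theorem not_both_poles (h : PoleForm D N c a b d) (h' : PoleForm D N c' a' b' d') (hd : d ≠ d')
    {ξ : Fin n → LaurentSeries F}
    (hξ : ∀ q ∈ MvPolynomial.vanishingIdeal F (fracPoints D N), MvPolynomial.aeval ξ q = 0)
    {m : ℤ} (hm : m < 0) (hc : (∑ i, HahnSeries.C (c i) * ξ i : LaurentSeries F).coeff m ≠ 0)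
    (hc' : (∑ i, HahnSeries.C (c' i) * ξ i : LaurentSeries F).coeff m ≠ 0) : False := by
  have key := hξ _ (h.relation_mem h')
  simp only [map_sub _ (_ * _), map_sub _ _ (_ * _ * _), map_mul, MvPolynomial.aeval_C,
    aeval_affineForm, algebraMap_laurentSeries] at key
  have hz : (∑ i, HahnSeries.C (c i) * ξ i - HahnSeries.C a : LaurentSeries F).coeff m ≠ 0 := by
    simpa [HahnSeries.C_apply, HahnSeries.coeff_single_of_ne hm.ne] using hc
  have hz' : (∑ i, HahnSeries.C (c' i) * ξ i - HahnSeries.C a' : LaurentSeries F).coeff m ≠ 0 := by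
    simpa [HahnSeries.C_apply, HahnSeries.coeff_single_of_ne hm.ne] using hc'
  generalize (∑ i, HahnSeries.C (c i) * ξ i - HahnSeries.C a : LaurentSeries F) = z at key hz
  generalize (∑ i, HahnSeries.C (c' i) * ξ i - HahnSeries.C a' : LaurentSeries F) = z' at key hz'
  have ho := (HahnSeries.order_le_of_coeff_ne_zero hz).trans_lt hm
  have ho' := (HahnSeries.order_le_of_coeff_ne_zero hz').trans_lt hm
  have hz0 : z ≠ 0 := by rintro rfl; simp at hz
  have hz0' : z' ≠ 0 := by rintro rfl; simp at hz'
  rw [mul_assoc] at key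
  -- Both orders are negative, so their sum lies below each of them and only the product term
  -- contributes.
  have h1 := congrArg (fun x : LaurentSeries F => x.coeff (z.order + z'.order)) key
  simp only [HahnSeries.C_mul_eq_smul, HahnSeries.coeff_sub, HahnSeries.coeff_smul,
    HahnSeries.coeff_mul_order_add_order, HahnSeries.coeff_zero] at h1
  rw [HahnSeries.coeff_eq_zero_of_lt_order (x := z) (by omega),
    HahnSeries.coeff_eq_zero_of_lt_order (x := z') (by omega)] at h1
  simp [sub_eq_zero, hd.symm, hz0, hz0'] at h1

end PoleForm

/-! ### Hypercircles: the dichotomy between lines over `K` and poles outside `K`. -/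

section Hypercircles

variable {K L F : Type*} [Field K] [Field L] [Algebra K L] [Field F] [Algebra K F]

theorem isLine_iff {n : ℕ} {U : Set (Fin n → F)} :
    IsLine U ↔ ∃ p v : Fin n → F, v ≠ 0 ∧ U = baseLine F p v := by
  have : ∀ p v : Fin n → F, {x | ∃ s : F, x = p + s • v} = baseLine F p v := fun p v => by
    ext x
    simp [baseLine, funext_iff]
  simp only [IsLine, this]

theorem isLine_baseLine {n : ℕ} {p v : Fin n → K} (hv : v ≠ 0) : IsLine (baseLine F p v) := by
  refine isLine_iff.mpr ⟨fun i => algebraMap K F (p i), fun i => algebraMap K F (v i), ?_, rfl⟩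
  obtain ⟨j, hj⟩ := Function.ne_iff.mp hv
  exact Function.ne_iff.mpr ⟨j, by simpa using hj⟩

theorem isPoly_linear (a b : L) : IsPoly (RatFunc.C b + RatFunc.C a * RatFunc.X) :=
  ⟨Polynomial.C b + Polynomial.C a * Polynomial.X, by
    rw [map_add, map_mul, RatFunc.algebraMap_C, RatFunc.algebraMap_C, RatFunc.algebraMap_X]⟩

variable [FiniteDimensional K L] {α : L} {U : Set (Fin (Module.finrank K L) → F)}

theorem exists_polynomial_generator [CharZero F] (hα : IntermediateField.adjoin K {α} = ⊤)
    {p v : Fin (Module.finrank K L) → K} (hv : v ≠ 0) :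
    ∃ w : RatFunc L, IsPoly w ∧ Generates α w (baseLine F p v) := by
  exact ⟨_, isPoly_linear _ _,
    (generates_linear_iff hα (fun h0 => hv (sum_powers_eq_zero hα h0)) rfl rfl).2 rfl⟩

theorem Generates.eq_baseLine_of_root [CharZero F] (hα : IntermediateField.adjoin K {α} = ⊤)
    {u : RatFunc L} (hU : Generates α u U)
    (hu : ¬ IsPoly u → ∃ k : K, u.denom.IsRoot (algebraMap K L k)) :
    ∃ p v : Fin (Module.finrank K L) → K, v ≠ 0 ∧ U = baseLine F p v := by
  rcases hU.1.cases with ⟨a, b, ha, rfl⟩ | ⟨a, b, d, hb, rfl⟩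
  · obtain ⟨p, hp⟩ := exists_sum_powers hα b
    obtain ⟨v, hv⟩ := exists_sum_powers hα a
    refine ⟨p, v, ?_, (generates_linear_iff hα ha hp hv).1 hU⟩
    rintro rfl
    simp at hv
    exact ha hv
  · obtain ⟨k, hk⟩ := hu (not_isPoly_pole hb)
    rw [denom_pole hb] at hk
    have hd : d = algebraMap K L (-k) := by
      simp only [Polynomial.IsRoot, Polynomial.eval_add, Polynomial.eval_X, Polynomial.eval_C] at hk
      rw [map_neg]
      linear_combination hk
    subst hd
    exact hU.eq_baseLine_of_pole hα hb _

/-- A hypercircle generated by a unit whose pole is not in `K` has none of the properties of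
a line. -/
theorem Generates.not_lineLike [CharZero K] [CharZero F] [IsAlgClosed F] {a b d : L} (hb : b ≠ 0)
    (hd : ∀ k : K, d ≠ algebraMap K L k)
    (hα : IntermediateField.adjoin K {α} = ⊤)
    (hU : Generates α (RatFunc.C a + RatFunc.C b / (RatFunc.X + RatFunc.C d)) U) :
    ¬ PolyParametrizable F U ∧ ¬ OneBranchAtInfinity F U ∧ ¬ OneBranchAtInfinity K U := by
  obtain ⟨D, N, hD, rfl, hN⟩ := hU.exists_pole_data
  obtain ⟨σ, τ, hστ⟩ := exists_algHom_ne (F := F) hd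
  have hform : ∀ σ : L →ₐ[K] F,
      PoleForm D N (fun i => σ (α ^ (i : ℕ))) (σ a) (σ b) (σ d) := fun σ =>
    ⟨by simpa using hb, hN σ⟩
  refine ⟨not_polyParametrizable (hform σ) (hform τ) hστ hD,
    not_oneBranchAtInfinity (hform σ) (hform τ) hστ hD, ?_⟩
  -- Over `K` already existence fails. The coefficients of `ξ` at a pole order of one coordinate
  -- form a nonzero vector over `K`, so its combination with the powers of `α` is nonzero in `L`, as
  -- are all conjugates. Both forms then have a pole.
  rintro ⟨⟨ξ, hξ⟩, -⟩
  obtain ⟨j, hj⟩ := hξ.pole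
  have hne : (ξ j).coeff (ξ j).order ≠ 0 := by
    rw [Ne, HahnSeries.coeff_order_eq_zero]
    intro h0
    simp [h0] at hj
  have hsum : ∑ i, algebraMap K L ((ξ i).coeff (ξ j).order) * α ^ (i : ℕ) ≠ 0 := fun h0 =>
    hne (congrFun (sum_powers_eq_zero hα h0) j)
  have hpole : ∀ σ : L →ₐ[K] F, (∑ i : Fin (Module.finrank K L), HahnSeries.C (σ (α ^ (i : ℕ))) *
      (ξ i).map (algebraMap K F) : LaurentSeries F).coeff (ξ j).order ≠ 0 := fun σ => by
    have h1 : σ (∑ i, algebraMap K L ((ξ i).coeff (ξ j).order) * α ^ (i : ℕ)) ≠ 0 := by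
      exact (map_ne_zero_iff σ σ.toRingHom.injective).mpr hsum
    convert h1 using 1
    rw [map_sum, HahnSeries.coeff_sum]
    refine Finset.sum_congr rfl fun i _ => ?_
    rw [HahnSeries.C_mul_eq_smul, HahnSeries.coeff_smul, HahnSeries.map_coeff, map_mul,
      AlgHom.commutes, smul_eq_mul, mul_comm]
  refine not_both_poles (hform σ) (hform τ) hστ (fun q hq => ?_) hj (hpole σ) (hpole τ)
  exact hξ.equations q (by rwa [vanishingIdeal_zeroLocus_vanishingIdeal])

theorem Generates.root_of_lineLike [CharZero K] [CharZero F] [IsAlgClosed F]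
    (hα : IntermediateField.adjoin K {α} = ⊤) {w : RatFunc L} (hU : Generates α w U)
    (h : PolyParametrizable F U ∨ OneBranchAtInfinity F U ∨ OneBranchAtInfinity K U)
    (hw : ¬ IsPoly w) : ∃ k : K, w.denom.IsRoot (algebraMap K L k) := by
  rcases hU.1.cases with ⟨a, b, ha, rfl⟩ | ⟨a, b, d, hb, rfl⟩
  · exact absurd (isPoly_linear a b) hw
  · by_contra hno
    have hd : ∀ k : K, d ≠ algebraMap K L k := by
      rintro k rfl
      exact hno ⟨-k, by simp [denom_pole hb]⟩
    have := hU.not_lineLike hb hd hα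
    tauto

end Hypercircles

end Hypercircle

end

theorem mainTheorem5 {K L F : Type*} [Field K] [CharZero K] [Field L] [Algebra K L]
    [FiniteDimensional K L] [Field F] [Algebra K F] [IsAlgClosure K F]
    (α : L) (hα : IntermediateField.adjoin K {α} = ⊤)
    (u : RatFunc L) (U : Set (Fin (Module.finrank K L) → F))
    (hU : Hypercircle.Generates (K := K) α u U) :
    List.TFAE
      [Hypercircle.IsLine U,
       ∃ w : RatFunc L, Hypercircle.IsPoly w ∧ Hypercircle.Generates (K := K) α w U,
       ∀ w : RatFunc L, Hypercircle.Generates (K := K) α w U → ¬ Hypercircle.IsPoly w →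
         ∃ k : K, w.denom.IsRoot (algebraMap K L k),
       Hypercircle.PolyParametrizable F U,
       Hypercircle.OneBranchAtInfinity F U,
       Hypercircle.PolyParametrizable K U,
       Hypercircle.OneBranchAtInfinity K U] := by
  have : IsAlgClosed F := IsAlgClosure.isAlgClosed K
  have : CharZero F := charZero_of_injective_algebraMap (algebraMap K F).injective
  -- The pivot of the equivalences: `U` is a line defined over `K`, not merely over `F`.
  let Rational : Prop :=
    ∃ p v : Fin (Module.finrank K L) → K, v ≠ 0 ∧ U = Hypercircle.baseLine F p v
  have rational (h : Hypercircle.PolyParametrizable F U ∨ Hypercircle.OneBranchAtInfinity F U ∨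
      Hypercircle.OneBranchAtInfinity K U) : Rational :=
    hU.eq_baseLine_of_root hα (hU.root_of_lineLike hα h)
  tfae_have 1 → 4 := by
    rw [Hypercircle.isLine_iff]
    rintro ⟨p, v, hv, rfl⟩
    exact Hypercircle.polyParametrizable_baseLine hv
  tfae_have 4 → 6 := fun h => by
    obtain ⟨p, v, hv, rfl⟩ := rational (Or.inl h)
    exact Hypercircle.polyParametrizable_baseLine hv
  tfae_have 6 → 4 := Hypercircle.PolyParametrizable.of_algebra
  tfae_have 4 → 5 := fun h => by
    obtain ⟨p, v, hv, rfl⟩ := rational (Or.inl h)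
    exact Hypercircle.oneBranchAtInfinity_baseLine
      (p := fun i => algebraMap K F (p i)) (v := fun i => algebraMap K F (v i)) fun h0 => hv <|
        funext fun i => (algebraMap K F).injective (by simpa using congrFun h0 i)
  tfae_have 5 → 7 := fun h => by
    obtain ⟨p, v, hv, rfl⟩ := rational (Or.inr (Or.inl h))
    exact Hypercircle.oneBranchAtInfinity_baseLine hv
  tfae_have 7 → 2 := fun h => by
    obtain ⟨p, v, hv, rfl⟩ := rational (Or.inr (Or.inr h))
    exact Hypercircle.exists_polynomial_generator hα hv
  tfae_have 2 → 1 := by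
    rintro ⟨w, hw, hwU⟩
    -- The root condition is void for a polynomial generator.
    obtain ⟨p, v, hv, rfl⟩ := hwU.eq_baseLine_of_root hα fun h => absurd hw h
    exact Hypercircle.isLine_baseLine hv
  tfae_have 4 → 3 := fun h w hwU hw => hwU.root_of_lineLike hα (Or.inl h) hw
  tfae_have 3 → 1 := fun h => by
    obtain ⟨p, v, hv, rfl⟩ := hU.eq_baseLine_of_root hα (h u hU)
    exact Hypercircle.isLine_baseLine hv
  tfae_finish
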